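/- All graphs are finite and simple, possibly disconnected or empty; $n(G)$ is the number of vertices of $G$. In the Maker-Breaker domination game on $G$, Dominator and Staller alternately select a vertex not selected before, and Dominator wins as soon as the vertices he has selected form a dominating set of $G$ (every vertex of $G$ is selected by him or adjacent to a vertex selected by him); otherwise Staller wins. Let $\gamma_{\rm MB}(G)\in\{0,1,2,\dots\}\cup\{\infty\}$ be the least $k$ such that Dominator, moving first, has a strategy that wins with at most $k$ moves of his own, and $\infty$ if he has no winning strategy; $\gamma'_{\rm MB}(G)$ is defined in the same way for the game in which Staller moves first. Both numbers are $0$ for the empty graph. A pendant $P_2$ of a graph is a pair of adjacent vertices $x,y$ such that $x$ is a leaf and $y$ has exactly one neighbor besides $x$; a connected component isomorphic to $P_2$ is also regarded as a pendant $P_2$. A residual graph $R(G)$ of $G$ is an induced subgraph obtained from $G$ by iteratively deleting the two vertices of a pendant $P_2$ of the current graph until no pendant $P_2$ is left. **Theorem.** Let $R(G)$ be any residual graph of $G$ and let $H=G-V(R(G))$. Then $n(H)$ is even and (i) $\gamma'_{\rm MB}(G)=\frac{n(H)}{2}+\gamma'_{\rm MB}(R(G))$, (ii) $\frac{n(H)}{2}+\gamma_{\rm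 MB}(R(G))-1\le\gamma_{\rm MB}(G)\le\frac{n(H)}{2}+\gamma_{\rm MB}(R(G))$, with the usual conventions for $\infty$ (in particular $\infty-1=\infty$). -/

import Mathlib

namespace SimpleGraph

variable {V : Type*}

/-- `D` is a dominating set of `G`: the closed neighbourhoods of its elements cover all vertices. -/
def MBIsDominating (G : SimpleGraph V) (D : Set V) : Prop :=
  ∀ v, ∃ u ∈ D, u = v ∨ G.Adj u v

/-- One turn of Staller, at the position in which Dominator has selected the set `D` and Staller
the set `S`. Dominator has already won if `D` is dominating. Otherwise Staller must select an
unplayed vertex (if there is none, Dominator has lost), and the next position has to satisfy `P`,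
whatever vertex she selects. -/
def MBStallerTurn (G : SimpleGraph V) (P : Set V → Set V → Prop) (D S : Set V) : Prop :=
  G.MBIsDominating D ∨
    ((∃ w, w ∉ D ∪ S) ∧ ∀ w, w ∉ D ∪ S → P D (insert w S))

/-- `G.MBDominatorWins k D S`: at the position in which Dominator has selected `D`, Staller has
selected `S` and it is Dominator's turn, Dominator has a strategy that wins the Maker-Breaker
domination game with at most `k` further moves of his own. -/
def MBDominatorWins (G : SimpleGraph V) : ℕ → Set V → Set V → Prop
  | 0, D, _ => G.MBIsDominating D
  | k + 1, D, S => G.MBIsDominating D ∨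
      ∃ v, v ∉ D ∪ S ∧ G.MBStallerTurn (G.MBDominatorWins k) (insert v D) S

/-- The Maker-Breaker domination number: the least `k` such that Dominator, playing first, has a
strategy to win with at most `k` of his moves; it is `⊤` if he has no winning strategy. -/
noncomputable def mbDomNumber (G : SimpleGraph V) : ℕ∞ :=
  ⨅ (k : ℕ) (_ : G.MBDominatorWins k ∅ ∅), (k : ℕ∞)

/-- The Maker-Breaker domination number of the game in which Staller plays first. -/
noncomputable def mbDomNumber' (G : SimpleGraph V) : ℕ∞ :=
  ⨅ (k : ℕ) (_ : G.MBStallerTurn (G.MBDominatorWins k) ∅ ∅), (k : ℕ∞)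

/-- In the subgraph of `G` induced by `W`, the edge `xy` is a pendant `P₂`: `x` is a leaf with
neighbour `y`, and `y` has exactly one further neighbour `z`, through which the path is attached to
the rest; or else `xy` is a whole component (a `P₂` that is attached to nothing). -/
def IsPendantP2In (G : SimpleGraph V) (W : Set V) (x y : V) : Prop :=
  x ∈ W ∧ y ∈ W ∧ G.neighborSet x ∩ W = {y} ∧
    ((∃ z, z ≠ x ∧ G.neighborSet y ∩ W = {x, z}) ∨ G.neighborSet y ∩ W = {x})

/-- `W'` arises from `W` by removing the two vertices of one pendant `P₂` of `G.induce W`. -/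
def RemovesPendantP2 (G : SimpleGraph V) (W W' : Set V) : Prop :=
  ∃ x y, G.IsPendantP2In W x y ∧ W' = W \ {x, y}

/-- `R` is the vertex set of a residual graph of `G`: it is reached from the set of all vertices by
successively removing pendant `P₂`s, and `G.induce R` has no pendant `P₂`. -/
def IsResidualSet (G : SimpleGraph V) (R : Set V) : Prop :=
  Relation.ReflTransGen G.RemovesPendantP2 Set.univ R ∧ ∀ x y, ¬ G.IsPendantP2In R x y

end SimpleGraph

namespace SimpleGraph

variable {V : Type*}

/-! The proof works in a relaxed game (`DomWins`, `DomWins'`) that records only the undominated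
vertices and those Staller has not taken, and lets her pass. By `mbDominatorWins_iff` this changes
no outcome, and positions become monotone (`DomWins.mono`). Upper bounds: Dominator answers inside
each pendant pair, at one move per pair (`DomWins.pair`). If Staller starts, she strips each pair by
playing `y`, which forces the leaf `x`, and `x` dominates nothing outside the pair
(`PendantReduction.domWins'_of`). If Dominator opens with `v`, Staller strips pairs until she meets
the one containing `v`. If `v` is its leaf, Dominator keeps a spare vertex that helps at most `z`
(`bound_of_extra`); if `v` is the support vertex, `z` is dominated for free (`bound_of_dominated`).
Stripping goes on unless this advantage sits on the leaf of the next pair. There Staller plays a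
support vertex: each reply is harmless, moves the advantage to an attachment vertex, or loses to a
double threat. Once all pairs are gone, the advantage is worth at most the first move on `R`. -/

/-- The closed neighbourhood of a vertex. -/
def closedNbhd (G : SimpleGraph V) (v : V) : Set V := {u | u = v ∨ G.Adj u v}

theorem mem_closedNbhd {G : SimpleGraph V} {u v : V} :
    u ∈ G.closedNbhd v ↔ u = v ∨ G.Adj u v := Iff.rfl

theorem mem_closedNbhd_comm {G : SimpleGraph V} {u v : V} :
    u ∈ G.closedNbhd v ↔ v ∈ G.closedNbhd u := by
  simp only [mem_closedNbhd, G.adj_comm u v, eq_comm]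

/-- The domination game in which the vertices of `Q` still have to be dominated and Staller has
not yet taken the vertices of `B`. It is Dominator's turn, and he wins within `k` of his moves.
Staller is allowed to pass, and vertices may be selected repeatedly, to no effect. -/
def DomWins (G : SimpleGraph V) : ℕ → Set V → Set V → Prop
  | 0, Q, _ => Q = ∅
  | k + 1, Q, B => Q = ∅ ∨ ∃ v ∈ B, DomWins G k (Q \ G.closedNbhd v) B ∧
      ∀ w, DomWins G k (Q \ G.closedNbhd v) (B \ {w})

/-- The variant of `DomWins` in which it is Staller's turn. -/
def DomWins' (G : SimpleGraph V) (k : ℕ) (Q B : Set V) : Prop :=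
  G.DomWins k Q B ∧ ∀ w, G.DomWins k Q (B \ {w})

/-! ### Monotonicity, forced replies and pairing in the relaxed game. -/

section Game

variable {G : SimpleGraph V} {k l : ℕ} {Q Q' B B' : Set V}

theorem domWins_succ_iff : G.DomWins (k + 1) Q B ↔
    Q = ∅ ∨ ∃ v ∈ B, G.DomWins' k (Q \ G.closedNbhd v) B := Iff.rfl

theorem domWins_empty : G.DomWins k ∅ B := by
  cases k
  · rfl
  · exact Or.inl rfl

theorem DomWins.succ (h : G.DomWins k Q B) : G.DomWins (k + 1) Q B := by
  induction k generalizing Q B with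
  | zero => exact Or.inl h
  | succ k ih =>
    rcases h with h | ⟨v, hv, h, h'⟩
    · exact Or.inl h
    · exact Or.inr ⟨v, hv, ih h, fun w => ih (h' w)⟩

theorem DomWins.mono_left (h : G.DomWins k Q B) (hkl : k ≤ l) : G.DomWins l Q B := by
  induction hkl with
  | refl => exact h
  | step _ ih => exact ih.succ

theorem DomWins'.mono_left (h : G.DomWins' k Q B) (hkl : k ≤ l) : G.DomWins' l Q B :=
  ⟨h.1.mono_left hkl, fun w => (h.2 w).mono_left hkl⟩

/-- Only vertices that can still dominate something in `Q'` matter. If the winning move is missing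
from `B'`, it was useless, and Dominator skips it because Staller may pass. -/
theorem DomWins.mono (h : G.DomWins k Q B) (hQ : Q' ⊆ Q)
    (hB : ∀ q ∈ Q', ∀ b ∈ B, q ∈ G.closedNbhd b → b ∈ B') : G.DomWins k Q' B' := by
  induction k generalizing Q B Q' B' with
  | zero => exact Set.subset_eq_empty hQ h
  | succ k ih =>
    rcases h with h | ⟨v, hv, h, h'⟩
    · exact Or.inl (Set.subset_eq_empty hQ h)
    · have key : G.DomWins' k (Q' \ G.closedNbhd v) B' := by
        refine ⟨ih h (Set.sdiff_subset_sdiff_left hQ) fun q hq => hB q hq.1, fun w =>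
          ih (h' w) (Set.sdiff_subset_sdiff_left hQ) fun q hq b hb hqb =>
            ⟨hB q hq.1 b hb.1 hqb, hb.2⟩⟩
      by_cases hv' : v ∈ B'
      · exact Or.inr ⟨v, hv', key⟩
      · have : Q' \ G.closedNbhd v = Q' :=
          sdiff_eq_left.2 (Set.disjoint_left.2 fun q hq hqv => hv' (hB q hq v hv hqv))
        rw [this] at key
        exact key.1.succ

theorem DomWins'.mono (h : G.DomWins' k Q B) (hQ : Q' ⊆ Q)
    (hB : ∀ q ∈ Q', ∀ b ∈ B, q ∈ G.closedNbhd b → b ∈ B') : G.DomWins' k Q' B' :=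
  ⟨h.1.mono hQ hB, fun w => (h.2 w).mono hQ fun q hq b hb hqb => ⟨hB q hq b hb.1 hqb, hb.2⟩⟩

theorem DomWins.exists_dominator (h : G.DomWins k Q B) {q : V} (hq : q ∈ Q) :
    ∃ b ∈ B, q ∈ G.closedNbhd b := by
  induction k generalizing Q with
  | zero => exact absurd hq (by rw [show Q = ∅ from h]; simp)
  | succ k ih =>
    rcases h with h | ⟨v, hv, h, -⟩
    · simp [h] at hq
    · by_cases hqv : q ∈ G.closedNbhd v
      · exact ⟨v, hv, hqv⟩
      · exact ih h ⟨hq, hqv⟩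

theorem DomWins'.reply (h : G.DomWins' k Q B) (hQ : Q.Nonempty) (w : V) :
    ∃ l v, k = l + 1 ∧ v ∈ B ∧ v ≠ w ∧ G.DomWins' l (Q \ G.closedNbhd v) (B \ {w}) := by
  have hw := h.2 w
  cases k with
  | zero => exact absurd (show Q = ∅ from hw) hQ.ne_empty
  | succ l =>
    rcases hw with hw | ⟨v, hv, hw⟩
    · exact absurd hw hQ.ne_empty
    · exact ⟨l, v, rfl, hv.1, hv.2, hw⟩

/-- Staller can force the reply `u` to her move `w` if only `u` and `w` can dominate `q`. -/
theorem DomWins'.force (h : G.DomWins' k Q B) {q w u : V} (hq : q ∈ Q)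
    (hqB : ∀ b ∈ B, q ∈ G.closedNbhd b → b = w ∨ b = u) (hQ : Q' ⊆ Q)
    (hu : ∀ p ∈ Q', p ∉ G.closedNbhd u)
    (hB : ∀ p ∈ Q', ∀ b ∈ B, b ≠ w → b ≠ u → p ∈ G.closedNbhd b → b ∈ B') :
    ∃ l, k = l + 1 ∧ G.DomWins' l Q' B' := by
  obtain ⟨l, v, rfl, hv, hvw, h⟩ := h.reply ⟨q, hq⟩ w
  refine ⟨l, rfl, ?_⟩
  by_cases hqv : q ∈ G.closedNbhd v
  · obtain rfl := (hqB v hv hqv).resolve_left hvw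
    refine h.mono (fun p hp => ⟨hQ hp, hu p hp⟩) fun p hp b hb hpb => ?_
    refine hB p hp b hb.1 hb.2 ?_ hpb
    rintro rfl
    exact hu p hp hpb
  -- If the reply leaves `q` undominated, Staller takes `u` too and `q` is lost.
  · obtain ⟨b, hb, hqb⟩ := (h.2 u).exists_dominator ⟨hq, hqv⟩
    rcases hqB b hb.1.1 hqb with rfl | rfl
    · exact absurd rfl hb.1.2
    · exact absurd rfl hb.2

/-- Staller wins if one of her moves makes two threats that Dominator cannot meet together. -/
theorem DomWins'.fork (h : G.DomWins' k Q B) {p q : V} (w a b : V) (hp : p ∈ Q) (hq : q ∈ Q)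
    (hpB : ∀ c ∈ B, p ∈ G.closedNbhd c → c = w ∨ c = a)
    (hqB : ∀ c ∈ B, q ∈ G.closedNbhd c → c = w ∨ c = b) (hab : a ≠ b) : False := by
  obtain ⟨l, v, rfl, hv, hvw, h⟩ := h.reply ⟨q, hq⟩ w
  by_cases hpv : p ∈ G.closedNbhd v
  · have hqv : q ∉ G.closedNbhd v := fun hqv =>
      hab (((hpB v hv hpv).resolve_left hvw).symm.trans ((hqB v hv hqv).resolve_left hvw))
    obtain ⟨c, hc, hqc⟩ := (h.2 b).exists_dominator ⟨hq, hqv⟩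
    exact (hqB c hc.1.1 hqc).elim hc.1.2 hc.2
  · obtain ⟨c, hc, hpc⟩ := (h.2 a).exists_dominator ⟨hp, hpv⟩
    exact (hpB c hc.1.1 hpc).elim hc.1.2 hc.2

theorem domWins_succ_pair {x y : V} (hxy : G.Adj x y) :
    G.DomWins (k + 1) (∅ ∪ {x, y}) (B ∪ {x, y}) := by
  refine Or.inr ⟨x, by simp, ?_⟩
  have : (∅ ∪ {x, y} : Set V) \ G.closedNbhd x = ∅ := by
    have hyx : y ∈ G.closedNbhd x := Or.inr hxy.symm
    have hx' : x ∈ G.closedNbhd x := Or.inl rfl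
    grind
  rw [this]
  exact ⟨domWins_empty, fun _ => domWins_empty⟩

/-- An isolated edge costs Dominator at most one further move. -/
theorem DomWins.pair {x y : V} (hxy : G.Adj x y) (hx : x ∉ B) (hy : y ∉ B)
    (h : G.DomWins k Q B) : G.DomWins (k + 1) (Q ∪ {x, y}) (B ∪ {x, y}) := by
  have hne := hxy.ne
  have hyx : y ∈ G.closedNbhd x := Or.inr hxy.symm
  have hxy' : x ∈ G.closedNbhd y := Or.inr hxy
  have hx' : x ∈ G.closedNbhd x := Or.inl rfl
  have hy' : y ∈ G.closedNbhd y := Or.inl rfl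
  induction k generalizing Q B with
  | zero =>
    rw [show Q = ∅ from h]
    exact domWins_succ_pair hxy
  | succ k ih =>
    rcases h with rfl | ⟨v, hv, h, h'⟩
    · exact domWins_succ_pair hxy
    · refine Or.inr ⟨v, Or.inl hv, ?_⟩
      have sub : (Q ∪ {x, y}) \ G.closedNbhd v ⊆ (Q \ G.closedNbhd v) ∪ {x, y} := by grind
      refine ⟨(ih hx hy h).mono sub (by grind), fun w => ?_⟩
      -- A move in the pair is answered in the pair, which restores the position after `v` with
      -- Staller to move.
      by_cases hwx : w = x
      · subst hwx
        refine Or.inr ⟨y, by grind, ?_⟩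
        exact DomWins'.mono (Q := Q \ G.closedNbhd v) (B := B) ⟨h, h'⟩ (by grind) (by grind)
      by_cases hwy : w = y
      · subst hwy
        refine Or.inr ⟨x, by grind, ?_⟩
        exact DomWins'.mono (Q := Q \ G.closedNbhd v) (B := B) ⟨h, h'⟩ (by grind) (by grind)
      exact (ih (fun h => hx h.1) (fun h => hy h.1) (h' w)).mono sub (by grind)

theorem DomWins'.pair {x y : V} (hxy : G.Adj x y) (hx : x ∉ B) (hy : y ∉ B)
    (h : G.DomWins' k Q B) : G.DomWins' (k + 1) (Q ∪ {x, y}) (B ∪ {x, y}) := by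
  have hne := hxy.ne
  have hyx : y ∈ G.closedNbhd x := Or.inr hxy.symm
  have hxy' : x ∈ G.closedNbhd y := Or.inr hxy
  have hx' : x ∈ G.closedNbhd x := Or.inl rfl
  have hy' : y ∈ G.closedNbhd y := Or.inl rfl
  refine ⟨h.1.pair hxy hx hy, fun w => ?_⟩
  by_cases hwx : w = x
  · subst hwx
    exact Or.inr ⟨y, by grind, h.mono (by grind) (by grind)⟩
  by_cases hwy : w = y
  · subst hwy
    exact Or.inr ⟨x, by grind, h.mono (by grind) (by grind)⟩
  exact ((h.2 w).pair hxy (fun h => hx h.1) (fun h => hy h.1)).mono subset_rfl (by grind)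

/-! ### Comparison with the actual game -/

theorem MBStallerTurn.imp {P P' : Set V → Set V → Prop} {D S : Set V}
    (h : G.MBStallerTurn P D S) (hP : ∀ D S, P D S → P' D S) : G.MBStallerTurn P' D S :=
  Or.imp_right (fun h => ⟨h.1, fun w hw => hP _ _ (h.2 w hw)⟩) h

theorem MBDominatorWins.succ {D S : Set V} (h : G.MBDominatorWins k D S) :
    G.MBDominatorWins (k + 1) D S := by
  induction k generalizing D S with
  | zero => exact Or.inl h
  | succ k ih =>
    rcases h with h | ⟨v, hv, h⟩
    · exact Or.inl h
    · exact Or.inr ⟨v, hv, h.imp fun _ _ => ih⟩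

/-- The vertices that are not dominated by a set. -/
def undominated (G : SimpleGraph V) (D : Set V) : Set V := {v | ∀ u ∈ D, v ∉ G.closedNbhd u}

theorem mem_undominated {D : Set V} {v : V} :
    v ∈ G.undominated D ↔ ∀ u ∈ D, v ∉ G.closedNbhd u := Iff.rfl

theorem mbIsDominating_iff {D : Set V} : G.MBIsDominating D ↔ G.undominated D = ∅ := by
  simp only [Set.eq_empty_iff_forall_notMem, mem_undominated, MBIsDominating, not_forall, not_not,
    mem_closedNbhd, exists_prop]
  simp only [G.adj_comm, eq_comm]

theorem undominated_insert {D : Set V} {v : V} :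
    G.undominated (insert v D) = G.undominated D \ G.closedNbhd v := by
  ext; simp [mem_undominated, and_comm]

theorem exists_unplayed {D S : Set V} (h : G.DomWins k (G.undominated D) Sᶜ)
    (hD : ¬ G.MBIsDominating D) : ∃ w, w ∉ D ∪ S := by
  rw [mbIsDominating_iff, ← ne_eq, ← Set.nonempty_iff_ne_empty] at hD
  obtain ⟨q, hq⟩ := hD
  obtain ⟨b, hb, hqb⟩ := h.exists_dominator hq
  exact ⟨b, fun h => h.elim (fun h => hq b h hqb) hb⟩

theorem compl_insert_eq {S : Set V} {w : V} : (insert w S)ᶜ = Sᶜ \ {w} := by grind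

/-- Passing never beats a real move, and taking a played vertex amounts to a pass: Dominator's
vertices dominate nothing undominated, and Staller's are already gone. -/
theorem mbStallerTurn_iff_of {P : Set V → Set V → Prop} {D S : Set V}
    (hP : ∀ D S, P D S ↔ G.DomWins k (G.undominated D) Sᶜ) :
    G.MBStallerTurn P D S ↔ G.DomWins' k (G.undominated D) Sᶜ := by
  constructor
  · rintro (h | ⟨⟨w, hw⟩, h⟩)
    · rw [mbIsDominating_iff.1 h]
      exact ⟨domWins_empty, fun _ => domWins_empty⟩
    · have key : G.DomWins k (G.undominated D) Sᶜ := by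
        have := (hP _ _).1 (h w hw)
        rw [compl_insert_eq] at this
        exact this.mono subset_rfl fun _ _ _ hb _ => hb.1
      refine ⟨key, fun u => ?_⟩
      by_cases hu : u ∈ D ∪ S
      · refine key.mono subset_rfl fun q hq b hb hqb => ⟨hb, ?_⟩
        rintro rfl
        exact hu.elim (fun h => hq _ h hqb) hb
      · have := (hP _ _).1 (h u hu)
        rwa [compl_insert_eq] at this
  · intro h
    by_cases hD : G.MBIsDominating D
    · exact Or.inl hD
    · refine Or.inr ⟨exists_unplayed h.1 hD, fun w _ => ?_⟩
      rw [hP, compl_insert_eq]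
      exact h.2 w

theorem mbDominatorWins_iff {D S : Set V} :
    G.MBDominatorWins k D S ↔ G.DomWins k (G.undominated D) Sᶜ := by
  induction k generalizing D S with
  | zero => exact mbIsDominating_iff
  | succ k ih =>
    have turn {D S : Set V} := mbStallerTurn_iff_of (D := D) (S := S) (fun _ _ => ih)
    constructor
    · rintro (h | ⟨v, hv, h⟩)
      · exact Or.inl (mbIsDominating_iff.1 h)
      · rw [turn, undominated_insert] at h
        exact Or.inr ⟨v, fun h => hv (Or.inr h), h⟩
    · rintro (h | ⟨v, hv, h⟩)
      · exact Or.inl (mbIsDominating_iff.2 h)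
      -- Selecting `v` again changes nothing, so that move is dropped and Staller's turn is taken to
      -- be a pass.
      · by_cases hvD : v ∈ D
        · refine MBDominatorWins.succ (ih.2 ?_)
          rw [← undominated_insert, Set.insert_eq_of_mem hvD] at h
          exact h.1
        · refine Or.inr ⟨v, fun h => h.elim hvD hv, turn.2 ?_⟩
          rw [undominated_insert]
          exact h

theorem mbStallerTurn_iff {D S : Set V} :
    G.MBStallerTurn (G.MBDominatorWins k) D S ↔ G.DomWins' k (G.undominated D) Sᶜ :=
  mbStallerTurn_iff_of fun _ _ => mbDominatorWins_iff

theorem undominated_empty : G.undominated ∅ = Set.univ := by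
  ext; simp [mem_undominated]

/-! ### Transfer of the game to induced subgraphs. -/

theorem image_sdiff_closedNbhd {U : Type*} (f : U ↪ V) (Q : Set U) (u : U) :
    f '' (Q \ (G.comap f).closedNbhd u) = f '' Q \ G.closedNbhd (f u) := by
  ext v
  constructor
  · rintro ⟨q, ⟨hq, hqu⟩, rfl⟩
    exact ⟨⟨q, hq, rfl⟩, fun h => hqu (h.imp_left fun h => f.injective h)⟩
  · rintro ⟨⟨q, hq, rfl⟩, hqu⟩
    exact ⟨q, ⟨hq, fun h => hqu (h.imp_left fun h => congrArg f h)⟩, rfl⟩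

theorem domWins'_image_iff_of {U : Type*} (f : U ↪ V)
    (h : ∀ Q B : Set U, (G.comap f).DomWins k Q B ↔ G.DomWins k (f '' Q) (f '' B)) (Q B : Set U) :
    (G.comap f).DomWins' k Q B ↔ G.DomWins' k (f '' Q) (f '' B) := by
  have him (w : U) : f '' (B \ {w}) = f '' B \ {f w} := by
    rw [Set.image_sdiff f.injective, Set.image_singleton]
  refine and_congr (h Q B) ⟨fun H w => ?_, fun H w => ?_⟩
  · by_cases hw : ∃ u, f u = w
    · obtain ⟨u, rfl⟩ := hw
      rw [← him, ← h]
      exact H u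
    · have hB : f '' B \ {w} = f '' B := by
        rw [Set.sdiff_singleton_eq_self]
        rintro ⟨u, -, hu⟩
        exact hw ⟨u, hu⟩
      rw [hB, ← h]
      by_cases hU : Nonempty U
      · exact (H hU.some).mono subset_rfl fun _ _ _ hb _ => hb.1
      · have : Q = ∅ := Set.eq_empty_of_forall_notMem fun q _ => hU ⟨q⟩
        rw [this]
        exact domWins_empty
  · rw [h, him]
    exact H _

theorem domWins_image_iff {U : Type*} (f : U ↪ V) (Q B : Set U) :
    (G.comap f).DomWins k Q B ↔ G.DomWins k (f '' Q) (f '' B) := by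
  induction k generalizing Q B with
  | zero => simp [DomWins]
  | succ k ih =>
    simp only [domWins_succ_iff, Set.image_eq_empty, Set.exists_mem_image,
      domWins'_image_iff_of f ih, image_sdiff_closedNbhd]

theorem domWins'_image_iff {U : Type*} (f : U ↪ V) (Q B : Set U) :
    (G.comap f).DomWins' k Q B ↔ G.DomWins' k (f '' Q) (f '' B) :=
  domWins'_image_iff_of f (domWins_image_iff f) Q B

theorem induce_mbDominatorWins_iff {R : Set V} :
    (G.induce R).MBDominatorWins k ∅ ∅ ↔ G.DomWins k R R := by
  rw [mbDominatorWins_iff, undominated_empty, Set.compl_empty, induce, domWins_image_iff]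
  simp

theorem induce_mbStallerTurn_iff {R : Set V} :
    (G.induce R).MBStallerTurn ((G.induce R).MBDominatorWins k) ∅ ∅ ↔ G.DomWins' k R R := by
  rw [mbStallerTurn_iff, undominated_empty, Set.compl_empty, induce, domWins'_image_iff]
  simp

end Game

/-! ### Pendant pairs and Staller's strategies. -/

section PendantPairs

variable {G : SimpleGraph V}

/-- In the subgraph induced by `W`, the vertex `x` is a leaf with neighbour `y`, and `y` has no
other neighbour except possibly `z`. -/
structure IsPendantPair (G : SimpleGraph V) (W : Set V) (x y z : V) : Prop where
  left_mem : x ∈ W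
  right_mem : y ∈ W
  adj : G.Adj x y
  eq_of_adj_left : ∀ u ∈ W, G.Adj x u → u = y
  eq_of_adj_right : ∀ u ∈ W, G.Adj y u → u = x ∨ u = z

/-- `R` is obtained from `W` by successively removing `n` pendant pairs. -/
inductive PendantReduction (G : SimpleGraph V) (R : Set V) : ℕ → Set V → Prop
  | refl : PendantReduction G R 0 R
  | step {n : ℕ} {W : Set V} {x y z : V} : G.IsPendantPair W x y z →
      PendantReduction G R n (W \ {x, y}) → PendantReduction G R (n + 1) W

theorem IsPendantP2In.exists_isPendantPair {W : Set V} {x y : V} (h : G.IsPendantP2In W x y) :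
    ∃ z, G.IsPendantPair W x y z := by
  obtain ⟨hx, hy, hN, hN'⟩ := h
  have hxy : y ∈ G.neighborSet x ∩ W := hN ▸ rfl
  have key : ∃ z, G.neighborSet y ∩ W ⊆ {x, z} := by
    rcases hN' with ⟨z, -, hz⟩ | hz
    · exact ⟨z, hz.subset⟩
    -- An isolated edge has no attachment vertex; `x` serves as a dummy `z`.
    · exact ⟨x, by simp [hz]⟩
  obtain ⟨z, hz⟩ := key
  exact ⟨z, hx, hy, hxy.1, fun u hu hxu => hN.subset ⟨hxu, hu⟩, fun u hu hyu => hz ⟨hyu, hu⟩⟩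

namespace IsPendantPair

variable {W W' : Set V} {x y z : V}

theorem mono (h : G.IsPendantPair W x y z) (hW : W' ⊆ W) (hx : x ∈ W') (hy : y ∈ W') :
    G.IsPendantPair W' x y z :=
  ⟨hx, hy, h.adj, fun u hu => h.eq_of_adj_left u (hW hu),
    fun u hu => h.eq_of_adj_right u (hW hu)⟩

theorem ne (h : G.IsPendantPair W x y z) : x ≠ y := h.adj.ne

/-- Bundled as input for `grind`, which settles the side goals of the forcing steps. -/
theorem facts (h : G.IsPendantPair W x y z) :
    x ∈ W ∧ y ∈ W ∧ x ≠ y ∧ x ∈ G.closedNbhd y ∧ y ∈ G.closedNbhd x ∧ x ∈ G.closedNbhd x ∧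
    y ∈ G.closedNbhd y ∧ (∀ b ∈ W, x ∈ G.closedNbhd b → b = x ∨ b = y) ∧
    (∀ b ∈ W, y ∈ G.closedNbhd b → b = x ∨ b = y ∨ b = z) ∧
    (∀ q ∈ W, q ∈ G.closedNbhd x → q = x ∨ q = y) ∧
    (∀ q ∈ W, q ∈ G.closedNbhd y → q = x ∨ q = y ∨ q = z) := by
  obtain ⟨hx, hy, hxy, hl, hr⟩ := h
  have hl' := fun u hu (h : G.Adj u x) => hl u hu h.symm
  have hr' := fun u hu (h : G.Adj u y) => hr u hu h.symm
  have := hxy.ne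
  have := hxy.symm
  simp only [mem_closedNbhd]
  grind

end IsPendantPair

/-- A pendant pair of a later stage can be removed first. -/
theorem PendantReduction.swap {R W : Set V} {n : ℕ} {x y z x' y' : V}
    (h : G.IsPendantPair W x y z) (hx' : x' ∈ W \ {x, y}) (hy' : y' ∈ W \ {x, y})
    (hR : G.PendantReduction R n ((W \ {x, y}) \ {x', y'})) :
    G.PendantReduction R (n + 1) (W \ {x', y'}) := by
  have := h.left_mem
  have := h.right_mem
  refine .step (h.mono Set.sdiff_subset (by grind) (by grind)) ?_
  rwa [Set.sdiff_sdiff_comm]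

variable {R W : Set V} {n k : ℕ}

/-- Staller forces a move in every pendant pair, when she moves first. -/
theorem PendantReduction.domWins'_of (hR : G.PendantReduction R n W) (h : G.DomWins' k W W) :
    ∃ m, n + m ≤ k ∧ G.DomWins' m R R := by
  induction hR generalizing k with
  | refl => exact ⟨k, by omega, h⟩
  | @step n W x y z hp hR ih =>
    obtain ⟨hx, hy, hne, hxy, hyx, hxx, hyy, hxN, hyN, hxN', hyN'⟩ := hp.facts
    obtain ⟨l, hk, h⟩ := h.force (q := x) (w := y) (u := x) (Q' := W \ {x, y})
      (B' := W \ {x, y}) hx (by grind) (by grind) (by grind) (by grind)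
    obtain ⟨m, hm, h⟩ := ih h
    exact ⟨m, by omega, h⟩

theorem PendantReduction.domWins_of (hR : G.PendantReduction R n W) (h : G.DomWins' k W W) :
    ∃ m, n + m ≤ k ∧ G.DomWins m R R :=
  let ⟨m, hm, h⟩ := hR.domWins'_of h
  ⟨m, hm, h.1⟩

/-- Staller's bound if, besides `W`, there is a vertex `y` that is still to be dominated, which is
possible by the extra vertex `x` or by `z`. -/
theorem PendantReduction.bound_of_pending (hR : G.PendantReduction R n W) {x y z : V}
    (hy : y ∉ W) (hxW : ∀ q ∈ W, q ∉ G.closedNbhd x)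
    (hyW : ∀ b ∈ W, y ∈ G.closedNbhd b → b = z)
    (h : G.DomWins' k (insert y W) (insert x W)) :
    ∃ m, n + m + 1 ≤ k ∧ G.DomWins m R R := by
  have key : ∀ (l : ℕ) (W : Set V), z ∉ W → (∀ b ∈ W, y ∈ G.closedNbhd b → b = z) →
      ¬ G.DomWins' l (insert y W) (insert x W) := by
    intro l W hz hyW h
    obtain ⟨b, hb, hqb⟩ := (h.2 x).exists_dominator (Set.mem_insert y W)
    grind
  induction hR generalizing k with
  | refl =>
    by_cases hz : z ∈ R
    -- Staller's move `z` forces `x`; giving `z` back afterwards only helps Dominator.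
    · obtain ⟨l, hk, h⟩ := h.force (q := y) (w := z) (u := x) (Q' := R) (B' := R)
        (by grind) (by grind) (by grind) (by grind) (by grind)
      exact ⟨l, by omega, h.1⟩
    · exact absurd h (key _ _ hz hyW)
  | @step n W x₁ y₁ z₁ hp hR ih =>
    obtain ⟨hx₁, hy₁, hne, hxy, hyx, hxx, hyy, hxN, hyN, hxN', hyN'⟩ := hp.facts
    have hxW' := fun h => hxW x h (Or.inl rfl)
    -- If `z` lies in the pair, Staller's move there threatens both `y` and the leaf `x₁`.
    by_cases hzx : z = x₁
    · exact (h.fork (p := y) (q := x₁) z x y₁ (by grind) (by grind) (by grind) (by grind)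
        (by grind)).elim
    by_cases hzy : z = y₁
    · exact (h.fork (p := y) (q := x₁) z x x₁ (by grind) (by grind) (by grind) (by grind)
        (by grind)).elim
    · obtain ⟨l, hk, h⟩ := h.force (q := x₁) (w := y₁) (u := x₁) (Q' := insert y (W \ {x₁, y₁}))
        (B' := insert x (W \ {x₁, y₁})) (by grind) (by grind) (by grind) (by grind) (by grind)
      obtain ⟨m, hm, h⟩ := ih (by grind) (by grind) (by grind) h
      exact ⟨m, by omega, h⟩

/-- The second pair of a reduction can be forced first if its leaf is not attached to the first
pair. -/
theorem IsPendantPair.facts_of_second {x y z x' y' z' : V} (h : G.IsPendantPair W x y z)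
    (h' : G.IsPendantPair (W \ {x, y}) x' y' z') (hz : z ≠ x') :
    ∀ b ∈ W, x' ∈ G.closedNbhd b → b = x' ∨ b = y' := by
  obtain ⟨-, -, -, -, -, -, -, -, -, hxN', hyN'⟩ := h.facts
  obtain ⟨hx', -, -, -, -, -, -, hxN, -⟩ := h'.facts
  grind

theorem domWins_succ_of_selected {v : V} (hv : v ∈ R)
    (h : G.DomWins' k (R \ G.closedNbhd v) R) : G.DomWins (k + 1) R R :=
  Or.inr ⟨v, hv, h⟩

/-- Staller's bound if, besides `W`, there is an extra vertex `d` that can dominate `z` only. -/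
theorem PendantReduction.bound_of_extra (hR : G.PendantReduction R n W) {d z : V}
    (hd : d ∉ W) (hdW : ∀ q ∈ W, q ∈ G.closedNbhd d → q = z)
    (h : G.DomWins' k W (insert d W)) :
    ∃ m, n + m ≤ k ∧ G.DomWins m R R := by
  induction n using Nat.strong_induction_on generalizing k W d z with
  | _ n IH =>
  cases hR with
  | refl => exact ⟨k, by omega, (h.2 d).mono (by grind) (by grind)⟩
  | @step n _ x₁ y₁ z₁ hp hR =>
    obtain ⟨hx, hy, hne, hxy, hyx, hxx, hyy, hxN, hyN, hxN', hyN'⟩ := hp.facts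
    -- Only here can `x₁` be dominated from outside its pair, so that `y₁` need not force `x₁`.
    by_cases hzx : z = x₁
    · -- it suffices to treat the case that Dominator owns `z₁`
      have main : (∀ l, z₁ ∈ W \ {x₁, y₁} →
          G.DomWins' l ((W \ {x₁, y₁}) \ G.closedNbhd z₁) (W \ {x₁, y₁}) →
          ∃ m, n + m ≤ l + 1 ∧ G.DomWins m R R) → ∃ m, n + 1 + m ≤ k ∧ G.DomWins m R R := by
        intro hz₁
        obtain ⟨l, v, rfl, hv, hvy, h⟩ := h.reply ⟨x₁, hx⟩ y₁
        by_cases hvx : v = x₁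
        · obtain ⟨m, hm, h⟩ := IH n (by omega) (W := W \ {x₁, y₁}) (d := d) (z := z) hR
            (by grind) (by grind) (h.mono (by grind) (by grind))
          exact ⟨m, by omega, h⟩
        by_cases hvd : v = d
        · have hyd : y₁ ∉ G.closedNbhd d := by grind
          obtain ⟨m, hm, h⟩ := hR.bound_of_pending (x := x₁) (y := y₁) (z := z₁) (k := l)
            (by grind) (by grind) (by grind) (h.mono (by grind) (by grind))
          exact ⟨m, by omega, h⟩
        -- Now `x₁` depends on itself and `d`: Staller takes `d`, forcing `x₁`, and Dominator's gain
        -- is `z₁`.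
        by_cases hvz : v = z₁
        · have hxv : x₁ ∉ G.closedNbhd v := by grind
          obtain ⟨l, hk, h⟩ := h.force (q := x₁) (w := d) (u := x₁)
            (Q' := (W \ {x₁, y₁}) \ G.closedNbhd v) (B' := W \ {x₁, y₁})
            (by grind) (by grind) (by grind) (by grind) (by grind)
          obtain ⟨m, hm, h⟩ := hz₁ l (by grind) (hvz ▸ h)
          exact ⟨m, by omega, h⟩
        · have hxv : x₁ ∉ G.closedNbhd v := by grind
          have hyv : y₁ ∉ G.closedNbhd v := by grind
          -- In this degenerate case `d` cannot dominate `y₁`; the second target of the fork is the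
          -- dummy `x₁`, taken by Staller herself.
          by_cases hdz : d = z₁
          · have hyd : y₁ ∉ G.closedNbhd d := by grind
            exact (h.fork (p := x₁) (q := y₁) x₁ d x₁ (by grind) (by grind) (by grind) (by grind)
              (by grind)).elim
          exact (h.fork (p := x₁) (q := y₁) x₁ d z₁ (by grind) (by grind) (by grind) (by grind)
            (by grind)).elim
      cases hR with
      | refl => exact main fun l hz h => ⟨l + 1, by omega, domWins_succ_of_selected hz h⟩
      | @step n _ x₂ y₂ z₂ hp₂ hR =>
        obtain ⟨hx₂, hy₂, hne₂, hxy₂, hyx₂, hxx₂, hyy₂, hxN₂, hyN₂, hxN₂', hyN₂'⟩ := hp₂.facts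
        by_cases hz₁ : z₁ = x₂
        -- Dominator owns the leaf `x₂`, so its partner `y₂` is the new spare vertex.
        · refine main fun l hz h => ?_
          obtain ⟨m, hm, h⟩ := IH n (by omega) (d := y₂) (z := z₂) hR (by grind) (by grind)
            (h.mono (k := l) (by grind) (by grind))
          exact ⟨m, by omega, h⟩
        · have hx₂N := hp.facts_of_second hp₂ hz₁
          obtain ⟨l, hk, h⟩ := h.force (q := x₂) (w := y₂) (u := x₂) (Q' := W \ {x₂, y₂})
            (B' := insert d (W \ {x₂, y₂})) (by grind) (by grind) (by grind)
            (by grind [mem_closedNbhd_comm]) (by grind)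
          obtain ⟨m, hm, h⟩ := IH (n + 1) (by omega) (d := d) (z := z) (hR.swap hp hx₂ hy₂)
            (by grind) (by grind) h
          exact ⟨m, by omega, h⟩
    by_cases hzy : z = y₁
    · obtain ⟨l, hk, h⟩ := h.force (q := x₁) (w := y₁) (u := x₁) (Q' := W \ {x₁, y₁})
        (B' := insert d (W \ {x₁, y₁})) (by grind) (by grind) (by grind) (by grind) (by grind)
      obtain ⟨m, hm, h⟩ := IH n (by omega) (d := d) (z := z) hR (by grind) (by grind) h
      exact ⟨m, by omega, h⟩
    · obtain ⟨l, hk, h⟩ := h.force (q := x₁) (w := y₁) (u := x₁) (Q' := W \ {x₁, y₁})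
        (B' := insert d (W \ {x₁, y₁})) (by grind) (by grind) (by grind) (by grind) (by grind)
      obtain ⟨m, hm, h⟩ := IH n (by omega) (d := d) (z := z) hR (by grind) (by grind) h
      exact ⟨m, by omega, h⟩

/-- Staller's bound if Dominator owns the leaf of the first pendant pair. -/
theorem PendantReduction.bound_of_selected_leaf {x y z : V} (hp : G.IsPendantPair W x y z)
    (hR : G.PendantReduction R n (W \ {x, y})) (h : G.DomWins' k (W \ G.closedNbhd x) W) :
    ∃ m, n + m ≤ k ∧ G.DomWins m R R := by
  obtain ⟨hx, hy, hne, hxy, hyx, hxx, hyy, hxN, hyN, hxN', hyN'⟩ := hp.facts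
  exact hR.bound_of_extra (d := y) (z := z) (by grind) (by grind) (h.mono (by grind) (by grind))


/-- Staller's bound if one vertex need not be dominated. -/
theorem PendantReduction.bound_of_dominated (hR : G.PendantReduction R n W) {z : V}
    (h : G.DomWins' k (W \ {z}) W) :
    ∃ m, n + m ≤ k + 1 ∧ G.DomWins m R R := by
  induction n using Nat.strong_induction_on generalizing k W z with
  | _ n IH =>
  cases hR with
  | refl =>
    -- Opening with `z` gives Dominator at least the free domination of `z`.
    by_cases hz : z ∈ R
    · have hzz : z ∈ G.closedNbhd z := Or.inl rfl
      exact ⟨k + 1, by omega, domWins_succ_of_selected hz (h.mono (by grind) (by grind))⟩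
    · exact ⟨k, by omega, h.1.mono (by grind) (by grind)⟩
  | @step n _ x₁ y₁ z₁ hp hR =>
    obtain ⟨hx, hy, hne, hxy, hyx, hxx, hyy, hxN, hyN, hxN', hyN'⟩ := hp.facts
    -- Only if the leaf itself is already dominated does `y₁` carry no threat to it.
    by_cases hzx : z = x₁
    · subst hzx
      by_cases hz₁ : z₁ ∉ W \ {z, y₁}
      · obtain ⟨l, hk, h⟩ := h.force (q := y₁) (w := y₁) (u := z) (Q' := W \ {z, y₁})
          (B' := W \ {z, y₁}) (by grind) (by grind) (by grind) (by grind) (by grind)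
        obtain ⟨m, hm, h⟩ := hR.domWins_of h
        exact ⟨m, by omega, h⟩
      rw [not_not] at hz₁
      cases hR with
      | refl =>
        obtain ⟨l, v, rfl, hv, hvy, h⟩ := h.reply ⟨y₁, by grind⟩ y₁
        by_cases hvx : v = z
        · exact ⟨l, by omega, h.1.mono (by grind) (by grind)⟩
        by_cases hvz : v = z₁
        · subst hvz
          exact ⟨l + 1, by omega, domWins_succ_of_selected hz₁ (h.mono (by grind) (by grind))⟩
        · have hyv : y₁ ∉ G.closedNbhd v := by grind
          obtain ⟨l, hk, h⟩ := h.force (q := y₁) (w := z₁) (u := z)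
            (Q' := (W \ {z, y₁}) \ G.closedNbhd v) (B' := W \ {z, y₁})
            (by grind) (by grind) (by grind) (by grind) (by grind)
          exact ⟨l + 1, by omega, domWins_succ_of_selected (by grind) h⟩
      | @step n _ x₂ y₂ z₂ hp₂ hR =>
        obtain ⟨hx₂, hy₂, hne₂, hxy₂, hyx₂, hxx₂, hyy₂, hxN₂, hyN₂, hxN₂', hyN₂'⟩ := hp₂.facts
        by_cases hz₁₂ : z₁ = x₂
        · subst hz₁₂
          -- it suffices to treat the case that Dominator owns `z₂`
          have main : (∀ l, z₂ ∈ (W \ {z, y₁}) \ {z₁, y₂} →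
              G.DomWins' l (((W \ {z, y₁}) \ {z₁, y₂}) \ G.closedNbhd z₂)
                ((W \ {z, y₁}) \ {z₁, y₂}) →
              ∃ m, n + m ≤ l + 1 ∧ G.DomWins m R R) →
              ∃ m, n + 1 + 1 + m ≤ k + 1 ∧ G.DomWins m R R := by
            intro hz₂
            -- After `y₂` is taken, `z₁` can be dominated only by itself or `y₁`, and `y₂` only by
            -- `z₁` or `z₂`.
            obtain ⟨l, v, rfl, hv, hvy, h⟩ := h.reply ⟨z₁, by grind⟩ y₂
            by_cases hvx : v = z₁
            · obtain ⟨m, hm, h⟩ := hR.domWins_of (k := l) (h.mono (by grind) (by grind))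
              exact ⟨m, by omega, h⟩
            by_cases hvy₁ : v = y₁
            · have hyv : y₂ ∉ G.closedNbhd v := by grind
              obtain ⟨m, hm, h⟩ := hR.bound_of_pending (x := z₁) (y := y₂) (z := z₂) (k := l)
                (by grind) (by grind) (by grind) (h.mono (by grind) (by grind))
              exact ⟨m, by omega, h⟩
            have hxv : z₁ ∉ G.closedNbhd v := by grind
            by_cases hvz : v = z₂
            · obtain ⟨l, hk, h⟩ := h.force (q := z₁) (w := z₁) (u := y₁)
                (Q' := ((W \ {z, y₁}) \ {z₁, y₂}) \ G.closedNbhd v)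
                (B' := (W \ {z, y₁}) \ {z₁, y₂})
                (by grind) (by grind) (by grind) (by grind) (by grind)
              by_cases hz₂W : z₂ ∈ (W \ {z, y₁}) \ {z₁, y₂}
              · obtain ⟨m, hm, h⟩ := hz₂ l hz₂W (hvz ▸ h)
                exact ⟨m, by omega, h⟩
              · obtain ⟨m, hm, h⟩ := hR.domWins_of (k := l) (h.mono (by grind) (by grind))
                exact ⟨m, by omega, h⟩
            · have hyv : y₂ ∉ G.closedNbhd v := by grind
              by_cases hz₂y : z₂ = y₁
              · have : y₂ ∉ G.closedNbhd y₁ := by grind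
                exact (h.fork (p := z₁) (q := y₂) z₁ y₁ z₁ (by grind) (by grind) (by grind)
                  (by grind) (by grind)).elim
              exact (h.fork (p := z₁) (q := y₂) z₁ y₁ z₂ (by grind) (by grind) (by grind)
                (by grind) (by grind)).elim
          cases hR with
          | refl => exact main fun l hz h => ⟨l + 1, by omega, domWins_succ_of_selected hz h⟩
          | @step n _ x₃ y₃ z₃ hp₃ hR =>
            obtain ⟨hx₃, hy₃, hne₃, -, -, hxx₃, hyy₃, hxN₃, hyN₃, hxN₃', hyN₃'⟩ := hp₃.facts
            by_cases hz₂₃ : z₂ = x₃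
            · refine main fun l hz h => ?_
              obtain ⟨m, hm, h⟩ := hR.bound_of_selected_leaf hp₃ (k := l) (hz₂₃ ▸ h)
              exact ⟨m, by omega, h⟩
            -- The leaf `x₃` touches neither earlier pair, so the third pair is stripped first and
            -- both earlier ones are kept for the induction.
            · have hx₃N := hp₂.facts_of_second hp₃ hz₂₃
              have hx₃N' : ∀ b ∈ W, x₃ ∈ G.closedNbhd b → b = x₃ ∨ b = y₃ := by grind
              obtain ⟨l, hk, h⟩ := h.force (q := x₃) (w := y₃) (u := x₃)
                (Q' := (W \ {x₃, y₃}) \ {z}) (B' := W \ {x₃, y₃}) (by grind) (by grind)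
                (by grind) (by grind [mem_closedNbhd_comm]) (by grind)
              have hR' := PendantReduction.swap hp₂ hx₃ hy₃ hR
              rw [Set.sdiff_sdiff_comm] at hR'
              obtain ⟨m, hm, h⟩ := IH (n + 2) (by omega) (z := z)
                (.step (hp.mono Set.sdiff_subset (by grind) (by grind)) hR') h
              exact ⟨m, by omega, h⟩
        · have hx₂N := hp.facts_of_second hp₂ hz₁₂
          obtain ⟨l, hk, h⟩ := h.force (q := x₂) (w := y₂) (u := x₂) (Q' := (W \ {x₂, y₂}) \ {z})
            (B' := W \ {x₂, y₂}) (by grind) (by grind) (by grind)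
            (by grind [mem_closedNbhd_comm]) (by grind)
          obtain ⟨m, hm, h⟩ := IH (n + 1) (by omega) (z := z) (hR.swap hp hx₂ hy₂) h
          exact ⟨m, by omega, h⟩
    · obtain ⟨l, hk, h⟩ := h.force (q := x₁) (w := y₁) (u := x₁) (Q' := (W \ {x₁, y₁}) \ {z})
        (B' := W \ {x₁, y₁}) (by grind) (by grind) (by grind) (by grind) (by grind)
      obtain ⟨m, hm, h⟩ := IH n (by omega) (z := z) hR h
      exact ⟨m, by omega, h⟩

/-- Staller's bound if Dominator owns an arbitrary vertex. -/
theorem PendantReduction.bound_of_selected (hR : G.PendantReduction R n W) {v : V} (hv : v ∈ W)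
    (h : G.DomWins' k (W \ G.closedNbhd v) W) :
    ∃ m, n + m ≤ k + 2 ∧ G.DomWins m R R := by
  induction hR generalizing k with
  -- Of the slack 2 in `k + 2`, one unit is the opening move `v`, which `k` does not count.
  | refl => exact ⟨k + 1, by omega, domWins_succ_of_selected hv h⟩
  | @step n W x₁ y₁ z₁ hp hR ih =>
    obtain ⟨hx, hy, hne, hxy, hyx, hxx, hyy, hxN, hyN, hxN', hyN'⟩ := hp.facts
    by_cases hvx : v = x₁
    · obtain ⟨m, hm, h⟩ := hR.bound_of_selected_leaf hp (k := k) (hvx ▸ h)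
      exact ⟨m, by omega, h⟩
    by_cases hvy : v = y₁
    · obtain ⟨m, hm, h⟩ := hR.bound_of_dominated (z := z₁) (k := k)
        (h.mono (by grind) (by grind))
      exact ⟨m, by omega, h⟩
    · obtain ⟨l, hk, h⟩ := h.force (q := x₁) (w := y₁) (u := x₁)
        (Q' := (W \ {x₁, y₁}) \ G.closedNbhd v) (B' := W \ {x₁, y₁})
        (by grind) (by grind) (by grind) (by grind) (by grind)
      obtain ⟨m, hm, h⟩ := ih (by grind) h
      exact ⟨m, by omega, h⟩

theorem PendantReduction.bound_of_domWins (hR : G.PendantReduction R n W)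
    (h : G.DomWins k W W) : ∃ m, n + m ≤ k + 1 ∧ G.DomWins m R R := by
  have start : W = ∅ → ∃ m, n + m ≤ k + 1 ∧ G.DomWins m R R := by
    rintro rfl
    cases hR with
    | refl => exact ⟨0, by omega, rfl⟩
    | step hp => exact absurd hp.left_mem (Set.notMem_empty _)
  cases k with
  | zero => exact start h
  | succ k =>
    rcases h with h | ⟨v, hv, h⟩
    · exact start h
    · exact hR.bound_of_selected hv h

/-! ### Dominator's pairing strategy and counting of pairs. -/

theorem sdiff_pair_union {x y : V} (hx : x ∈ W) (hy : y ∈ W) : W \ {x, y} ∪ {x, y} = W := by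
  grind

theorem PendantReduction.domWins (hR : G.PendantReduction R n W) (h : G.DomWins k R R) :
    G.DomWins (n + k) W W := by
  induction hR with
  | refl => exact h.mono_left (by omega)
  | @step n W x y z hp hR ih =>
    have := ih.pair hp.adj (by grind) (by grind)
    rw [sdiff_pair_union hp.left_mem hp.right_mem] at this
    exact this.mono_left (by omega)

theorem PendantReduction.domWins' (hR : G.PendantReduction R n W) (h : G.DomWins' k R R) :
    G.DomWins' (n + k) W W := by
  induction hR with
  | refl => exact h.mono_left (by omega)
  | @step n W x y z hp hR ih =>
    have := ih.pair hp.adj (by grind) (by grind)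
    rw [sdiff_pair_union hp.left_mem hp.right_mem] at this
    exact this.mono_left (by omega)

theorem PendantReduction.ncard_sdiff [Finite V] (hR : G.PendantReduction R n W) :
    R ⊆ W ∧ (W \ R).ncard = 2 * n := by
  induction hR with
  | refl => simp
  | @step n W x y z hp hR ih =>
    have := hp.left_mem
    have := hp.right_mem
    refine ⟨ih.1.trans Set.sdiff_subset, ?_⟩
    have hW : W \ R = (W \ {x, y}) \ R ∪ {x, y} := by
      have := ih.1
      grind
    rw [hW, Set.ncard_union_eq (by grind), ih.2, Set.ncard_pair hp.ne]
    omega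

theorem exists_pendantReduction (h : Relation.ReflTransGen G.RemovesPendantP2 W R) :
    ∃ n, G.PendantReduction R n W := by
  induction h using Relation.ReflTransGen.head_induction_on with
  | refl => exact ⟨0, .refl⟩
  | head h _ ih =>
    obtain ⟨n, ih⟩ := ih
    obtain ⟨x, y, hp, rfl⟩ := h
    obtain ⟨z, hp⟩ := hp.exists_isPendantPair
    exact ⟨n + 1, .step hp ih⟩

/-! ### From bounds on move counts to the domination numbers. -/

/-- Having `b` on the left avoids truncated subtraction; if no `k` satisfies `q`, the right side is
`⊤`. -/
theorem iInf_le_add_iInf {p q : ℕ → Prop} {a b : ℕ}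
    (h : ∀ k, q k → ∃ m, m + b ≤ a + k ∧ p m) :
    (⨅ (k : ℕ) (_ : p k), (k : ℕ∞)) + b ≤ a + ⨅ (k : ℕ) (_ : q k), (k : ℕ∞) := by
  by_cases hq : ∃ k, q k
  · obtain ⟨k, hk, hmin⟩ : ∃ k, q k ∧ (k : ℕ∞) = ⨅ (k : ℕ) (_ : q k), (k : ℕ∞) := by
      classical
      refine ⟨Nat.find hq, Nat.find_spec hq, le_antisymm ?_ (iInf₂_le _ (Nat.find_spec hq))⟩
      exact le_iInf₂ fun k hk => Nat.cast_le.2 (Nat.find_min' hq hk)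
    obtain ⟨m, hm, hpm⟩ := h k hk
    rw [← hmin]
    calc (⨅ (k : ℕ) (_ : p k), (k : ℕ∞)) + b ≤ (m : ℕ∞) + b := by
          gcongr
          exact iInf₂_le m hpm
      _ ≤ a + k := by exact_mod_cast hm
  · push Not at hq
    simp [hq]

theorem mbDomNumber_eq : G.mbDomNumber =
    ⨅ (k : ℕ) (_ : G.DomWins k Set.univ Set.univ), (k : ℕ∞) := by
  simp only [mbDomNumber, mbDominatorWins_iff, undominated_empty, Set.compl_empty]

theorem mbDomNumber'_eq : G.mbDomNumber' =
    ⨅ (k : ℕ) (_ : G.DomWins' k Set.univ Set.univ), (k : ℕ∞) := by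
  simp only [mbDomNumber', mbStallerTurn_iff, undominated_empty, Set.compl_empty]

theorem induce_mbDomNumber_eq : (G.induce R).mbDomNumber =
    ⨅ (k : ℕ) (_ : G.DomWins k R R), (k : ℕ∞) := by
  simp only [mbDomNumber, induce_mbDominatorWins_iff]

theorem induce_mbDomNumber'_eq : (G.induce R).mbDomNumber' =
    ⨅ (k : ℕ) (_ : G.DomWins' k R R), (k : ℕ∞) := by
  simp only [mbDomNumber', induce_mbStallerTurn_iff]

end PendantPairs

end SimpleGraph

theorem theorem4p4 {V : Type*} [Finite V] (G : SimpleGraph V) (R : Set V)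
    (hR : G.IsResidualSet R) :
    Even (Nat.card (Rᶜ : Set V)) ∧
    G.mbDomNumber' = ((Nat.card (Rᶜ : Set V) / 2 : ℕ) : ℕ∞) + (G.induce R).mbDomNumber' ∧
    ((Nat.card (Rᶜ : Set V) / 2 : ℕ) : ℕ∞) + (G.induce R).mbDomNumber ≤ G.mbDomNumber + 1 ∧
    G.mbDomNumber ≤ ((Nat.card (Rᶜ : Set V) / 2 : ℕ) : ℕ∞) + (G.induce R).mbDomNumber := by
  obtain ⟨n, hn⟩ := SimpleGraph.exists_pendantReduction hR.1
  have hcard : Nat.card (Rᶜ : Set V) = 2 * n := by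
    rw [Nat.card_coe_set_eq, Set.compl_eq_univ_sdiff]
    exact hn.ncard_sdiff.2
  have hhalf : Nat.card (Rᶜ : Set V) / 2 = n := by omega
  rw [hhalf, SimpleGraph.induce_mbDomNumber_eq, SimpleGraph.induce_mbDomNumber'_eq,
    SimpleGraph.mbDomNumber_eq, SimpleGraph.mbDomNumber'_eq]
  refine ⟨hcard ▸ even_two_mul n, le_antisymm ?_ ?_, ?_, ?_⟩
  · simpa using SimpleGraph.iInf_le_add_iInf (a := n) (b := 0)
      fun k hk => ⟨n + k, by omega, hn.domWins' hk⟩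
  · have := SimpleGraph.iInf_le_add_iInf (a := 0) (b := n) fun k hk =>
      let ⟨m, hm, h⟩ := hn.domWins'_of (k := k) hk
      ⟨m, by omega, h⟩
    simpa [add_comm] using this
  · have := SimpleGraph.iInf_le_add_iInf (a := 1) (b := n) fun k hk =>
      let ⟨m, hm, h⟩ := hn.bound_of_domWins (k := k) hk
      ⟨m, by omega, h⟩
    simpa [add_comm] using this
  · simpa using SimpleGraph.iInf_le_add_iInf (a := n) (b := 0)
      fun k hk => ⟨n + k, by omega, hn.domWins hk⟩
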